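/- Let $R$ be a ring (with $1$) of characteristic zero, so that $\mathbb{N} = \{0, 1, 2, \ldots\} \subseteq \mathbb{Z} \subseteq R$; for instance $R = \mathbb{Z}$, $\mathbb{Q}$, $\mathbb{R}$ or $\mathbb{C}$. Let $s = (s(n))_{n \geq 0}$ be a sequence of natural numbers that is C-recursive over $R$, that is, there are an integer $d \geq 1$ and elements $\alpha_1, \ldots, \alpha_d$ of $R$ with $\alpha_d \neq 0$ such that $$ s(n+d) + \alpha_1 s(n+d-1) + \ldots + \alpha_d s(n) = 0 \quad \text{for every integer } n \geq 0 . $$ Then $s$ is a Kalmar function. That is, there are a deterministic (multi-stack) Turing machine $M$ and an integer $k \geq 0$ such that, for every $n \in \mathbb{N}$, the machine $M$, started on the binary expansion of $n$ (least significant bit first, without leading zeros, so empty for $0$), halts with the binary expansion of $s(n)$, in the same format, as its output after at most $$ T_k(n) = 2^{2^{\iddots^{2^n}}} \quad (k \text{ twos}) $$ steps, where $T_0(n) = n$ and $T_{k+1}(n) = 2^{T_k(n)}$. -/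

import Mathlib

/-- The sequence `s` of elements of the ring `R` is C-recursive: for some `d ≥ 1` and some
coefficients `α 1, …, α d` in `R` with `α d ≠ 0`, one has
`s (n + d) + α 1 * s (n + d - 1) + ⋯ + α d * s n = 0` for every `n ≥ 0`.
(Only the values `α 1, …, α d` of `α` matter, and the subtraction never truncates.) -/
def IsCRecursive {R : Type*} [Ring R] (s : ℕ → R) : Prop :=
  ∃ d : ℕ, 1 ≤ d ∧ ∃ α : ℕ → R, α d ≠ 0 ∧
    ∀ n : ℕ, s (n + d) + ∑ i ∈ Finset.Icc 1 d, α i * s (n + d - i) = 0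

/-- The iterated exponential `2 ^ 2 ^ ⋯ ^ 2 ^ n` with `k` twos. -/
def expTower : ℕ → ℕ → ℕ
  | 0, n => n
  | k + 1, n => 2 ^ expTower k n

/-- `s` is a (univariate) Kalmar function: some deterministic multi-stack Turing machine
with binary input and output alphabets, started on the binary expansion of any `n` (least
significant bit first, no leading zeros, so empty for `0`), halts with
exactly the binary expansion of `s n` as output after at most `expTower k n` steps, where the
height `k` does not depend on `n`. -/
def IsKalmarFunction (s : ℕ → ℕ) : Prop :=
  ∃ (M : Turing.TM2ComputableAux Bool Bool) (k : ℕ), ∀ n : ℕ,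
    Nonempty (Turing.TM2OutputsInTime M.tm
      ((Computability.encodeNat n).map M.inputAlphabet.symm)
      (some ((Computability.encodeNat (s n)).map M.outputAlphabet.symm))
      (expTower k n))

/-! ### Reduction to an integral recurrence -/

/-! Because `ℚ` is divisible, there is an additive map `φ : R →+ ℚ` with `φ 1 = 1`. It satisfies `φ
(a * k) = φ a * k` for natural `k`, so it turns the recurrence into a rational one that still has
leading coefficient 1. Clearing denominators and moving negative terms across gives natural
coefficients (`IsCRecursive.exists_nat_recurrence`), and s grows at most exponentially
(`exists_le_pow_of_nat_recurrence`).

Any tower of fixed height is an admissible time bound, so the machine may be wasteful. It keeps d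
consecutive terms in unary and counts the binary input down to zero. Each decrement triggers a round
that shifts the window, collects the two sides of the recurrence, subtracts, and divides exactly by
q; `stage_eq_rest_add` and `stage_succ_eq_rest_add` check each loop of a round. After n rounds the
first counter holds s(n), which is written out by repeated binary increments.

If T bounds n, the terms involved and all loop counts, the run takes O(T²) steps
(`NatRecurrence.reach_halt`). Such a T can be chosen exponential in n, and `exists_pow_le_expTower`
concludes. -/

/-- A ring of characteristic zero admits an additive functional to `ℚ` that sends `1` to `1`. -/
theorem exists_addMonoidHom_rat_map_one (R : Type*) [Ring R] [CharZero R] :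
    ∃ φ : R →+ ℚ, φ 1 = 1 := by
  -- Divisibility makes `ℚ` injective, so `ℤ → ℚ` extends along the embedding `ℤ → R`.
  obtain ⟨φ, hφ⟩ := (Module.Baer.of_divisible ℚ).extension_property_addMonoidHom
    (Int.castAddHom R) Int.cast_injective (Int.castAddHom ℚ)
  refine ⟨φ, ?_⟩
  have := DFunLike.congr_fun hφ 1
  simpa using this

/-- A sequence of natural numbers that is C-recursive over a ring of characteristic zero satisfies
a linear recurrence with natural coefficients on both sides. -/
theorem IsCRecursive.exists_nat_recurrence {R : Type*} [Ring R] [CharZero R] {s : ℕ → ℕ}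
    (hs : IsCRecursive (fun n => (s n : R))) :
    ∃ d q : ℕ, 1 ≤ d ∧ 1 ≤ q ∧ ∃ p m : ℕ → ℕ, ∀ n,
      q * s (n + d) + ∑ j ∈ Finset.range d, m j * s (n + j) =
        ∑ j ∈ Finset.range d, p j * s (n + j) := by
  obtain ⟨d, hd, α, -, hα⟩ := hs
  obtain ⟨φ, hφ⟩ := exists_addMonoidHom_rat_map_one R
  have hcast : ∀ k : ℕ, φ (k : R) = k := fun k => by
    rw [← nsmul_one, map_nsmul, hφ, nsmul_one]
  have hmul : ∀ (a : R) (k : ℕ), φ (a * k) = φ a * k := fun a k => by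
    rw [← nsmul_eq_mul', map_nsmul, nsmul_eq_mul']
  have hrec : ∀ n, (s (n + d) : ℚ) + ∑ j ∈ Finset.range d, φ (α (d - j)) * s (n + j) = 0 := by
    intro n
    have h := congrArg φ (hα n)
    rw [map_add, map_sum, hcast, map_zero] at h
    simp only [hmul] at h
    rw [← h]
    congr 1
    refine Finset.sum_bij' (fun j _ => d - j) (fun i _ => d - i) ?_ ?_ ?_ ?_ ?_
    · intro j hj; simp only [Finset.mem_range, Finset.mem_Icc] at *; omega
    · intro j hj; simp only [Finset.mem_range, Finset.mem_Icc] at *; omega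
    · intro j hj; simp only [Finset.mem_range] at *; omega
    · intro j hj; simp only [Finset.mem_Icc] at *; omega
    · intro j hj
      simp only [Finset.mem_range] at hj
      rw [show n + d - (d - j) = n + j by omega]
  obtain ⟨⟨b, hb⟩, hint⟩ := IsLocalization.exist_integer_multiples (nonZeroDivisors ℤ)
    (Finset.range d) (fun j => φ (α (d - j)))
  have hb0 : b ≠ 0 := nonZeroDivisors.ne_zero hb
  have hint' : ∀ j, ∃ c : ℤ, j ∈ Finset.range d → (c : ℚ) = b * φ (α (d - j)) := by
    intro j
    by_cases hj : j ∈ Finset.range d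
    · obtain ⟨c, hc⟩ := hint j hj
      exact ⟨c, fun _ => by simpa using hc⟩
    · exact ⟨0, fun h => absurd h hj⟩
  choose c hc using hint'
  -- Multiplying by the sign of the common denominator `b` makes the leading coefficient `|b|`; the
  -- other coefficients are split into positive and negative parts.
  refine ⟨d, b.natAbs, hd, Int.natAbs_pos.2 hb0,
    fun j => (-(b.sign * c j)).toNat, fun j => (b.sign * c j).toNat, fun n => ?_⟩
  have key : |b| * s (n + d) + ∑ j ∈ Finset.range d, b.sign * c j * s (n + j) = 0 := by
    have h1 : (b : ℚ) * s (n + d) + ∑ j ∈ Finset.range d, (c j : ℚ) * s (n + j) = 0 := by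
      rw [← mul_zero (b : ℚ), ← hrec n, mul_add, Finset.mul_sum]
      congr 1
      exact Finset.sum_congr rfl fun j hj => by rw [hc j hj, mul_assoc]
    have h2 : b * s (n + d) + ∑ j ∈ Finset.range d, c j * s (n + j) = 0 := by exact_mod_cast h1
    have h3 := congrArg (b.sign * ·) h2
    simp only [mul_add, mul_zero, Finset.mul_sum, ← mul_assoc, Int.sign_mul_self_eq_natAbs, Int.natCast_natAbs] at h3
    exact h3
  zify
  rw [← sub_eq_zero, ← key, add_sub_assoc, ← Finset.sum_sub_distrib]
  congr 1
  refine Finset.sum_congr rfl fun j _ => ?_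
  rw [← sub_mul]
  congr 1
  omega

/-- A sequence satisfying a linear recurrence grows at most exponentially. -/
theorem exists_le_pow_of_nat_recurrence {s : ℕ → ℕ} {d q : ℕ} {p m : ℕ → ℕ} (hq : 1 ≤ q)
    (h : ∀ n, q * s (n + d) + ∑ j ∈ Finset.range d, m j * s (n + j) =
        ∑ j ∈ Finset.range d, p j * s (n + j)) :
    ∃ A, 2 ≤ A ∧ ∀ n, s n ≤ A ^ (n + 1) := by
  -- The sum dominates each initial value and the sum of the `p j`, as the base case and the
  -- induction step require.
  refine ⟨∑ j ∈ Finset.range d, (s j + p j) + 2, by omega, fun n => ?_⟩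
  set A := ∑ j ∈ Finset.range d, (s j + p j) + 2 with hA
  induction n using Nat.strong_induction_on with
  | _ n ih =>
    by_cases hn : n < d
    · have h1 : s n + p n ≤ ∑ j ∈ Finset.range d, (s j + p j) :=
        Finset.single_le_sum (f := fun j => s j + p j) (fun _ _ => Nat.zero_le _)
          (Finset.mem_range.2 hn)
      calc s n ≤ A := by omega
        _ ≤ A ^ (n + 1) := Nat.le_self_pow (by omega) A
    · obtain ⟨k, rfl⟩ := Nat.exists_eq_add_of_le' (not_lt.1 hn)
      have h1 : s (k + d) ≤ q * s (k + d) := Nat.le_mul_of_pos_left _ hq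
      have h2 := h k
      calc s (k + d) ≤ ∑ j ∈ Finset.range d, p j * s (k + j) := by omega
        _ ≤ ∑ j ∈ Finset.range d, p j * A ^ (k + d) := by
          refine Finset.sum_le_sum fun j hj => Nat.mul_le_mul_left _ ?_
          have hj := Finset.mem_range.1 hj
          exact (ih (k + j) (by omega)).trans
            (Nat.pow_le_pow_right (by omega) (by omega))
        _ = (∑ j ∈ Finset.range d, p j) * A ^ (k + d) := by rw [Finset.sum_mul]
        _ ≤ A * A ^ (k + d) := by
          refine Nat.mul_le_mul_right _ ?_
          rw [hA, Finset.sum_add_distrib]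
          omega
        _ = A ^ (k + d + 1) := by ring

/-! ### Towers of exponentials -/

/-- Each exponential adds at least one, as `n < 2 ^ n`. -/
theorem add_le_expTower (k n : ℕ) : n + k ≤ expTower k n := by
  induction k with
  | zero => exact le_rfl
  | succ k ih => exact (Nat.succ_le_succ ih).trans Nat.lt_two_pow_self

/-- Every exponential function is bounded by a tower of fixed height. -/
theorem exists_pow_le_expTower (A : ℕ) : ∃ k, ∀ n, A ^ (n + 1) ≤ expTower k n := by
  -- `A` twos absorb the shift in `n + A`, one more absorbs the product `A * (n + 1)`, and the last
  -- one the power itself.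
  refine ⟨A + 2, fun n => ?_⟩
  have h1 : A * (n + 1) ≤ expTower (A + 1) n := calc
    A * (n + 1) ≤ 2 ^ A * 2 ^ n := Nat.mul_le_mul Nat.lt_two_pow_self.le Nat.lt_two_pow_self
    _ = 2 ^ (n + A) := by rw [← pow_add, add_comm]
    _ ≤ 2 ^ expTower A n := Nat.pow_le_pow_right (by norm_num) (add_le_expTower A n)
  calc A ^ (n + 1) ≤ (2 ^ A) ^ (n + 1) := Nat.pow_le_pow_left Nat.lt_two_pow_self.le _
    _ = 2 ^ (A * (n + 1)) := (pow_mul _ _ _).symm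
    _ ≤ 2 ^ expTower (A + 1) n := Nat.pow_le_pow_right (by norm_num) h1

/-! ### Binary expansions -/

/-- The successor on binary expansions, least significant bit first. -/
def binSucc : List Bool → List Bool
  | [] => [true]
  | false :: w => true :: w
  | true :: w => false :: binSucc w

/-- The value of a binary expansion, least significant bit first. -/
def binVal : List Bool → ℕ
  | [] => 0
  | b :: w => b.toNat + 2 * binVal w

theorem binVal_binSucc (w : List Bool) : binVal (binSucc w) = binVal w + 1 := by
  induction w with
  | nil => rfl
  | cons b w ih => cases b <;> simp [binSucc, binVal, ih] <;> ring

theorem length_binSucc_le (w : List Bool) : (binSucc w).length ≤ w.length + 1 := by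
  induction w with
  | nil => simp [binSucc]
  | cons b w ih => cases b <;> simp [binSucc, ih]

theorem encodePosNum_succ (p : PosNum) :
    Computability.encodePosNum p.succ = binSucc (Computability.encodePosNum p) := by
  induction p with
  | one => rfl
  | bit0 p _ => rfl
  | bit1 p ih => simp [PosNum.succ, Computability.encodePosNum, binSucc, ih]

theorem encodeNat_succ (n : ℕ) :
    Computability.encodeNat (n + 1) = binSucc (Computability.encodeNat n) := by
  unfold Computability.encodeNat
  rw [Nat.cast_succ, Num.add_one]
  cases (n : Num) with
  | zero => rfl
  | pos p => exact encodePosNum_succ p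

theorem binVal_encodeNat (n : ℕ) : binVal (Computability.encodeNat n) = n := by
  induction n with
  | zero => rfl
  | succ n ih => rw [encodeNat_succ, binVal_binSucc, ih]

theorem length_encodeNat_le (n : ℕ) : (Computability.encodeNat n).length ≤ n := by
  induction n with
  | zero => rfl
  | succ n ih => rw [encodeNat_succ]; exact (length_binSucc_le _).trans (by omega)

/-- Incrementing from the empty word never creates leading zeros, so the output loop produces the
required format. -/
theorem iterate_binSucc_nil (n : ℕ) : binSucc^[n] [] = Computability.encodeNat n := by
  induction n with
  | zero => rfl
  | succ n ih => rw [Function.iterate_succ_apply', ih, encodeNat_succ]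

open Turing

/-! ### A family of Turing machines with two binary tapes and finitely many unary counters -/

/-- The stacks of a counter machine: binary input, binary output, and unary counters. -/
inductive Tape (m : ℕ) : Type
  | inp : Tape m
  | out : Tape m
  | cnt : Fin m → Tape m
  deriving DecidableEq, Fintype

/-- The labels of a counter machine. -/
inductive Lbl (m : ℕ) : Type
  | main : Lbl m
  | dec : Lbl m
  | restore : Lbl m
  | loop : Bool → Fin m → Lbl m
  | emit : Lbl m
  | inc : Lbl m
  | carry : Lbl m
  deriving Fintype

/-- The data of a counter machine. It first adds `init` to its counters. Then, for as long as the
binary input is positive, it decrements the input, with the counter `tmp` as auxiliary memory, and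
makes a pass over all counters `u`: while the counter `u` is positive, `u` is decremented, then
`sub u` is subtracted from the counters and `add u` is added to them. Finally it writes the value
of the counter `res` in binary, with the counter `aux` as auxiliary memory, and empties all
counters. -/
structure CounterProgram (m : ℕ) where
  init : Fin m → ℕ
  sub : Fin m → Fin m → ℕ
  add : Fin m → Fin m → ℕ
  first : Fin m
  tmp : Fin m
  aux : Fin m
  res : Fin m

theorem replicate_append_cons {α : Type*} (t : ℕ) (a : α) (l : List α) :
    List.replicate (t + 1) a ++ l = List.replicate t a ++ a :: l := by
  simp [List.replicate_succ']

namespace CounterProgram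

variable {m : ℕ}

/-- The statements of a counter machine. -/
abbrev CStmt (m : ℕ) : Type := TM2.Stmt (fun _ : Tape m => Bool) (Lbl m) (Option Bool)

/-- The configurations of a counter machine. -/
abbrev CCfg (m : ℕ) : Type := TM2.Cfg (fun _ : Tape m => Bool) (Lbl m) (Option Bool)

/-- The list of counters in which `u` occurs `f u` times. -/
def counterList (f : Fin m → ℕ) : List (Fin m) :=
  (List.finRange m).flatMap fun u => List.replicate (f u) u

theorem count_counterList (f : Fin m → ℕ) (u : Fin m) : (counterList f).count u = f u := by
  unfold counterList
  rw [List.count_flatMap]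
  simp only [Function.comp_def, List.count_replicate]
  rw [← Fin.sum_univ_def]
  simp

/-- Push a mark on each counter of the list. -/
def pushMarks (l : List (Fin m)) (q : CStmt m) : CStmt m :=
  l.foldr (fun u q => TM2.Stmt.push (.cnt u) (fun _ => true) q) q

/-- Pop a mark from each counter of the list. -/
def popMarks (l : List (Fin m)) (q : CStmt m) : CStmt m :=
  l.foldr (fun u q => TM2.Stmt.pop (.cnt u) (fun v _ => v) q) q

/-- Reset the internal state and jump. -/
def jump (l : Lbl m) : CStmt m := .load (fun _ => none) (.goto fun _ => l)

/-- Pop a symbol into the internal state. -/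
def read (k : Tape m) (q : CStmt m) : CStmt m := .pop k (fun _ o => o) q

/-- The statement that follows the loop of the counter `u`; `b` tells whether the machine is in
the final cleaning pass. -/
def next (b : Bool) (u : Fin m) : CStmt m :=
  if h : (u : ℕ) + 1 < m then jump (.loop b ⟨u + 1, h⟩) else if b then .halt else jump .dec

/-- The program of a counter machine. -/
def code (P : CounterProgram m) : Lbl m → CStmt m
  | .main => pushMarks (counterList P.init) (jump .dec)
  -- Decrementing keeps leading zeros, so zero is recognised only by exhausting the stack.
  | .dec => read .inp <| .branch (· == none) (jump .emit) <|
      .branch (· == some true) (.push .inp (fun _ => false) (jump .restore))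
        (pushMarks [P.tmp] (jump .dec))
  | .restore => read (.cnt P.tmp) <| .branch (· == none) (jump (.loop false P.first)) <|
      .push .inp (fun _ => true) (jump .restore)
  | .loop b u => read (.cnt u) <| .branch (· == none) (next b u) <|
      if b then jump (.loop b u) else
        popMarks (counterList (P.sub u)) (pushMarks (counterList (P.add u)) (jump (.loop b u)))
  | .emit => read (.cnt P.res) <| .branch (· == none) (jump (.loop true P.first)) (jump .inc)
  | .inc => read .out <| .branch (· == some true) (pushMarks [P.aux] (jump .inc))
      (.push .out (fun _ => true) (jump .carry))
  | .carry => read (.cnt P.aux) <| .branch (· == none) (jump .emit) <|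
      .push .out (fun _ => false) (jump .carry)

/-- The Turing machine of a counter program. -/
def machine (P : CounterProgram m) : FinTM2 where
  K := Tape m
  k₀ := .inp
  k₁ := .out
  Γ := fun _ => Bool
  Λ := Lbl m
  main := .main
  σ := Option Bool
  initialState := none
  Γk₀Fin := inferInstanceAs (Fintype Bool)
  m := P.code

/-! ### Configurations and the effect of single statements -/

/-- The contents of the stacks. -/
def tapes (w o : List Bool) (x : Fin m → ℕ) : (k : Tape m) → List Bool
  | .inp => w
  | .out => o
  | .cnt u => List.replicate (x u) true

/-- A configuration at a label, with the internal state reset. -/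
def cfg (l : Option (Lbl m)) (w o : List Bool) (x : Fin m → ℕ) : CCfg m :=
  ⟨l, none, tapes w o x⟩

@[simp] theorem update_tapes_inp (w o w' : List Bool) (x : Fin m → ℕ) :
    Function.update (tapes w o x) .inp w' = tapes w' o x := by
  funext k; cases k <;> simp [tapes, Function.update]

@[simp] theorem update_tapes_out (w o o' : List Bool) (x : Fin m → ℕ) :
    Function.update (tapes w o x) .out o' = tapes w o' x := by
  funext k; cases k <;> simp [tapes, Function.update]

@[simp] theorem update_tapes_cnt (w o : List Bool) (x : Fin m → ℕ) (u : Fin m) (a : ℕ) :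
    Function.update (tapes w o x) (.cnt u) (List.replicate a true) =
      tapes w o (Function.update x u a) := by
  funext k
  cases k with
  | inp => simp [tapes]
  | out => simp [tapes]
  | cnt u' =>
    by_cases h : u' = u
    · subst h; simp [tapes]
    · simp [tapes, h]

theorem stepAux_jump (l : Lbl m) (v : Option Bool) (w o : List Bool) (x : Fin m → ℕ) :
    TM2.stepAux (jump l) v (tapes w o x) = cfg (some l) w o x := rfl

theorem stepAux_pushMarks (l : List (Fin m)) (q : CStmt m) (v : Option Bool) (w o : List Bool)
    (x : Fin m → ℕ) :
    TM2.stepAux (pushMarks l q) v (tapes w o x) =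
      TM2.stepAux q v (tapes w o fun u => x u + l.count u) := by
  induction l generalizing x with
  | nil => rfl
  | cons u l ih =>
    have h : true :: tapes w o x (.cnt u) = List.replicate (x u + 1) true := rfl
    simp only [pushMarks, List.foldr_cons, TM2.stepAux] at ih ⊢
    rw [h, update_tapes_cnt, ih]
    congr 2
    funext u'
    by_cases hu : u' = u
    · subst hu; simp; ring
    · simp [hu, Ne.symm hu]

/-- Popping an empty stack does nothing, which matches truncated subtraction. -/
theorem stepAux_popMarks (l : List (Fin m)) (q : CStmt m) (v : Option Bool) (w o : List Bool)
    (x : Fin m → ℕ) :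
    TM2.stepAux (popMarks l q) v (tapes w o x) =
      TM2.stepAux q v (tapes w o fun u => x u - l.count u) := by
  induction l generalizing x with
  | nil => rfl
  | cons u l ih =>
    have h : (tapes w o x (.cnt u)).tail = List.replicate (x u - 1) true := by simp [tapes]
    simp only [popMarks, List.foldr_cons, TM2.stepAux] at ih ⊢
    rw [h, update_tapes_cnt, ih]
    congr 2
    funext u'
    by_cases hu : u' = u
    · subst hu; simp; omega
    · simp [hu, Ne.symm hu]

theorem stepAux_read_inp (q : CStmt m) (v : Option Bool) (w o : List Bool) (x : Fin m → ℕ) :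
    TM2.stepAux (read .inp q) v (tapes w o x) = TM2.stepAux q w.head? (tapes w.tail o x) := by
  simp [read, tapes]

theorem stepAux_read_out (q : CStmt m) (v : Option Bool) (w o : List Bool) (x : Fin m → ℕ) :
    TM2.stepAux (read .out q) v (tapes w o x) = TM2.stepAux q o.head? (tapes w o.tail x) := by
  simp [read, tapes]

theorem stepAux_read_cnt (q : CStmt m) (v : Option Bool) (w o : List Bool) (x : Fin m → ℕ)
    (u : Fin m) :
    TM2.stepAux (read (.cnt u) q) v (tapes w o x) =
      TM2.stepAux q (List.replicate (x u) true).head?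
        (tapes w o (Function.update x u (x u - 1))) := by
  simp [read, tapes]

/-! ### Timed reachability and single steps -/

/-- `P.Reach a b t`: the machine passes from the configuration `a` to `b` in at most `t` steps. -/
def Reach (P : CounterProgram m) (a b : CCfg m) (t : ℕ) : Prop :=
  Nonempty (StateTransition.EvalsToInTime (TM2.step P.code) a (some b) t)

variable {P : CounterProgram m} {a b c : CCfg m} {t t' : ℕ}

theorem Reach.refl (a : CCfg m) : P.Reach a a 0 := ⟨.refl _ _⟩

theorem Reach.trans (h : P.Reach a b t) (h' : P.Reach b c t') : P.Reach a c (t + t') := by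
  obtain ⟨h⟩ := h
  obtain ⟨h'⟩ := h'
  rw [add_comm]
  exact ⟨.trans _ _ _ _ _ _ h h'⟩

theorem Reach.mono (h : P.Reach a b t) (ht : t ≤ t') : P.Reach a b t' := by
  obtain ⟨h⟩ := h
  exact ⟨⟨h.toEvalsTo, h.steps_le_m.trans ht⟩⟩

theorem Reach.step (h : TM2.step P.code a = some b) : P.Reach a b 1 := ⟨⟨⟨1, h⟩, le_rfl⟩⟩

theorem Reach.head (h : TM2.step P.code a = some b) (h' : P.Reach b c t) : P.Reach a c (t + 1) :=
  ((Reach.step h).trans h').mono (by omega)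

variable {w o : List Bool} {x : Fin m → ℕ}

theorem step_main (P : CounterProgram m) :
    TM2.step P.code (cfg (some .main) w o fun _ => 0) = some (cfg (some .dec) w o P.init) := by
  simp [cfg, code, stepAux_pushMarks, count_counterList, stepAux_jump]

theorem step_dec_nil (P : CounterProgram m) :
    TM2.step P.code (cfg (some .dec) [] o x) = some (cfg (some .emit) [] o x) := by
  simp [cfg, code, stepAux_read_inp, stepAux_jump]

theorem step_dec_true (P : CounterProgram m) :
    TM2.step P.code (cfg (some .dec) (true :: w) o x) =
      some (cfg (some .restore) (false :: w) o x) := by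
  simp [cfg, code, stepAux_read_inp, stepAux_jump, tapes]

theorem step_dec_false (P : CounterProgram m) :
    TM2.step P.code (cfg (some .dec) (false :: w) o x) =
      some (cfg (some .dec) w o (Function.update x P.tmp (x P.tmp + 1))) := by
  simp only [cfg, code, TM2.step, stepAux_read_inp]
  simp [stepAux_jump, stepAux_pushMarks, cfg]
  congr 1
  funext u
  by_cases hu : u = P.tmp
  · subst hu; simp
  · simp [hu, Ne.symm hu]

theorem update_pred_of_eq_zero {u : Fin m} (h : x u = 0) : Function.update x u (x u - 1) = x := by
  rw [h, ← h, Function.update_eq_self_iff, h]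

theorem step_restore_zero (P : CounterProgram m) (h : x P.tmp = 0) :
    TM2.step P.code (cfg (some .restore) w o x) = some (cfg (some (.loop false P.first)) w o x) := by
  simp only [cfg, code, TM2.step, stepAux_read_cnt, update_pred_of_eq_zero h]
  simp [h, stepAux_jump, cfg]

theorem step_restore_succ (P : CounterProgram m) (h : x P.tmp ≠ 0) :
    TM2.step P.code (cfg (some .restore) w o x) =
      some (cfg (some .restore) (true :: w) o (Function.update x P.tmp (x P.tmp - 1))) := by
  simp only [cfg, code, TM2.step, stepAux_read_cnt]
  simp [h, stepAux_jump, cfg, List.head?_replicate, tapes]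

theorem step_emit_zero (P : CounterProgram m) (h : x P.res = 0) :
    TM2.step P.code (cfg (some .emit) w o x) = some (cfg (some (.loop true P.first)) w o x) := by
  simp only [cfg, code, TM2.step, stepAux_read_cnt, update_pred_of_eq_zero h]
  simp [h, stepAux_jump, cfg]

theorem step_emit_succ (P : CounterProgram m) (h : x P.res ≠ 0) :
    TM2.step P.code (cfg (some .emit) w o x) =
      some (cfg (some .inc) w o (Function.update x P.res (x P.res - 1))) := by
  simp only [cfg, code, TM2.step, stepAux_read_cnt]
  simp [h, stepAux_jump, cfg, List.head?_replicate]

theorem step_inc_nil (P : CounterProgram m) :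
    TM2.step P.code (cfg (some .inc) w [] x) = some (cfg (some .carry) w [true] x) := by
  simp [cfg, code, stepAux_read_out, stepAux_jump, tapes]

theorem step_inc_false (P : CounterProgram m) :
    TM2.step P.code (cfg (some .inc) w (false :: o) x) =
      some (cfg (some .carry) w (true :: o) x) := by
  simp [cfg, code, stepAux_read_out, stepAux_jump, tapes]

theorem step_inc_true (P : CounterProgram m) :
    TM2.step P.code (cfg (some .inc) w (true :: o) x) =
      some (cfg (some .inc) w o (Function.update x P.aux (x P.aux + 1))) := by
  simp only [cfg, code, TM2.step, stepAux_read_out]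
  simp [stepAux_jump, stepAux_pushMarks, cfg]
  congr 1
  funext u
  by_cases hu : u = P.aux
  · subst hu; simp
  · simp [hu, Ne.symm hu]

theorem step_carry_zero (P : CounterProgram m) (h : x P.aux = 0) :
    TM2.step P.code (cfg (some .carry) w o x) = some (cfg (some .emit) w o x) := by
  simp only [cfg, code, TM2.step, stepAux_read_cnt, update_pred_of_eq_zero h]
  simp [h, stepAux_jump, cfg]

theorem step_carry_succ (P : CounterProgram m) (h : x P.aux ≠ 0) :
    TM2.step P.code (cfg (some .carry) w o x) =
      some (cfg (some .carry) w (false :: o) (Function.update x P.aux (x P.aux - 1))) := by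
  simp only [cfg, code, TM2.step, stepAux_read_cnt]
  simp [h, stepAux_jump, cfg, List.head?_replicate, tapes]

/-- The label at which a pass arrives at the `j`-th counter, or leaves the last one. -/
def passLbl (m : ℕ) (b : Bool) (j : ℕ) : Option (Lbl m) :=
  if h : j < m then some (.loop b ⟨j, h⟩) else if b then none else some .dec

theorem step_loop_zero (P : CounterProgram m) (b : Bool) {u : Fin m} (h : x u = 0) :
    TM2.step P.code (cfg (some (.loop b u)) w o x) = some (cfg (passLbl m b (u + 1)) w o x) := by
  simp only [cfg, code, TM2.step, stepAux_read_cnt, update_pred_of_eq_zero h]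
  simp only [h, List.replicate_zero, List.head?_nil, TM2.stepAux, next, passLbl]
  split_ifs <;> simp [stepAux_jump, cfg]

theorem step_loop_true_succ (P : CounterProgram m) {u : Fin m} (h : x u ≠ 0) :
    TM2.step P.code (cfg (some (.loop true u)) w o x) =
      some (cfg (some (.loop true u)) w o (Function.update x u (x u - 1))) := by
  simp only [cfg, code, TM2.step, stepAux_read_cnt]
  simp [h, stepAux_jump, cfg, List.head?_replicate]

theorem step_loop_false_succ (P : CounterProgram m) {u : Fin m} (h : x u ≠ 0) :
    TM2.step P.code (cfg (some (.loop false u)) w o x) =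
      some (cfg (some (.loop false u)) w o fun k =>
        Function.update x u (x u - 1) k - P.sub u k + P.add u k) := by
  simp only [cfg, code, TM2.step, stepAux_read_cnt]
  simp [h, stepAux_jump, cfg, List.head?_replicate, stepAux_popMarks, stepAux_pushMarks,
    count_counterList]

/-! ### Runs of whole loops -/

/-- A loop of the main pass. -/
theorem reach_loop_false (P : CounterProgram m) (u : Fin m) (hu : P.add u u = 0) (a : ℕ)
    (y : Fin m → ℕ) (hy : y u = 0) :
    P.Reach (cfg (some (.loop false u)) w o fun k => y k + a * (P.sub u k + if k = u then 1 else 0))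
      (cfg (passLbl m false (u + 1)) w o fun k => y k + a * P.add u k) (a + 1) := by
  induction a generalizing y with
  | zero => simpa using Reach.step (step_loop_zero P false hy)
  | succ a ih =>
    -- An iteration trades one copy of `P.sub u`, plus one mark on `u`, for one copy of `P.add u`,
    -- which is absorbed into `y`. Since `P.add u u = 0`, the loop never refills its own counter.
    have h := ih (fun k => y k + P.add u k) (by simp [hy, hu])
    have e : (fun k => y k + P.add u k + a * P.add u k) = fun k => y k + (a + 1) * P.add u k := by
      funext k; ring
    rw [e] at h
    refine Reach.head ?_ h
    rw [step_loop_false_succ P (by simp)]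
    congr 2
    funext k
    by_cases hk : k = u
    · subst hk
      simp only [Function.update_self, if_true, add_mul, one_mul]
      omega
    · simp only [Function.update_of_ne hk, if_neg hk, add_mul, one_mul, add_zero]
      omega

/-- A loop of the cleaning pass. -/
theorem reach_loop_true (P : CounterProgram m) (u : Fin m) (a : ℕ) (x : Fin m → ℕ) (hx : x u = a) :
    P.Reach (cfg (some (.loop true u)) w o x)
      (cfg (passLbl m true (u + 1)) w o (Function.update x u 0)) (a + 1) := by
  induction a generalizing x with
  | zero =>
    rw [Function.update_eq_self_iff.2 hx.symm]
    exact Reach.step (step_loop_zero P true hx)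
  | succ a ih =>
    have h := ih (Function.update x u (x u - 1)) (by simp [hx])
    rw [Function.update_idem] at h
    exact Reach.head (step_loop_true_succ P (by omega)) h

/-- A pass over all counters is the composition of its loops. -/
theorem reach_pass (P : CounterProgram m) (b : Bool) (z : ℕ → Fin m → ℕ) (T : ℕ)
    (h : ∀ u : Fin m, P.Reach (cfg (some (.loop b u)) w o (z u))
      (cfg (passLbl m b (u + 1)) w o (z (u + 1))) T) (j : ℕ) (hj : j ≤ m) :
    P.Reach (cfg (passLbl m b 0) w o (z 0)) (cfg (passLbl m b j) w o (z j)) (j * T) := by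
  induction j with
  | zero => simpa using Reach.refl _
  | succ j ih =>
    have h' := h ⟨j, hj⟩
    rw [add_mul, one_mul]
    refine (ih (by omega)).trans ?_
    rwa [show passLbl m b j = some (.loop b ⟨j, hj⟩) from dif_pos hj]

/-- The cleaning pass. -/
theorem reach_clean (P : CounterProgram m) (T : ℕ) (hx : ∀ u, x u ≤ T) :
    P.Reach (cfg (passLbl m true 0) w o x) (cfg none w o fun _ => 0) (m * (T + 1)) := by
  -- Stage `j`: the counters before `j` are already empty.
  have h := reach_pass (w := w) (o := o) P true (fun j k => if (k : ℕ) < j then 0 else x k) (T + 1)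
    (fun u => by
      convert (reach_loop_true P u (x u) _ ?_).mono (Nat.succ_le_succ (hx u)) using 2
      · funext k
        by_cases hk : k = u
        · subst hk; simp
        · have : (k : ℕ) ≠ u := fun e => hk (Fin.ext e)
          rw [Function.update_of_ne hk]
          congr 1
          simp; omega
      · simp) m le_rfl
  simpa [passLbl] using h

/-- Decrementing a positive binary input. -/
theorem reach_dec_pos (P : CounterProgram m) (y : Fin m → ℕ) (hy : y P.tmp = 0) (w : List Bool)
    (hw : binVal w ≠ 0) :
    ∃ w', binVal w' + 1 = binVal w ∧ w'.length = w.length ∧ ∀ t,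
      P.Reach (cfg (some .dec) w o (Function.update y P.tmp t))
        (cfg (some (.loop false P.first)) (List.replicate t true ++ w') o y)
        (2 * w.length + t + 1) := by
  have restore : ∀ (t : ℕ) (w : List Bool),
      P.Reach (cfg (some .restore) w o (Function.update y P.tmp t))
        (cfg (some (.loop false P.first)) (List.replicate t true ++ w) o y) (t + 1) := by
    intro t
    induction t with
    | zero =>
      intro w
      rw [← hy, Function.update_eq_self, hy]
      exact Reach.step (step_restore_zero P hy)
    | succ t ih =>
      intro w
      have h := ih (true :: w)
      rw [← replicate_append_cons] at h
      refine Reach.head ?_ h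
      rw [step_restore_succ P (by simp)]
      simp
  -- Here `t` counts zeros already popped: the borrow turns them into ones, after the first true bit
  -- has become false.
  induction w with
  | nil => exact absurd rfl hw
  | cons b w ih =>
    cases b with
    | true =>
      refine ⟨false :: w, by simp [binVal, add_comm], rfl, fun t => ?_⟩
      exact (Reach.head (step_dec_true P) (restore t _)).mono (by simp)
    | false =>
      obtain ⟨w', h1, h2, h3⟩ := ih (by simpa [binVal] using hw)
      refine ⟨true :: w', by simp [binVal]; omega, by simp [h2], fun t => ?_⟩
      have h := h3 (t + 1)
      refine (Reach.head ?_ (by rwa [replicate_append_cons] at h)).mono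
        (t := 2 * w.length + (t + 1) + 1 + 1) (by simp; omega)
      rw [step_dec_false]; simp

/-- Decrementing fails on a binary expansion of zero. -/
theorem reach_dec_zero (P : CounterProgram m) (y : Fin m → ℕ) (w : List Bool)
    (hw : binVal w = 0) (t : ℕ) :
    P.Reach (cfg (some .dec) w o (Function.update y P.tmp t))
      (cfg (some .emit) [] o (Function.update y P.tmp (t + w.length))) (w.length + 1) := by
  -- Every digit is false and leaves a mark on `P.tmp`; these marks stay there.
  induction w generalizing t with
  | nil => exact Reach.step (step_dec_nil P)
  | cons b w ih =>
    cases b with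
    | true => simp [binVal] at hw
    | false =>
      have h := ih (by simpa [binVal] using hw) (t + 1)
      rw [add_assoc, add_comm 1] at h
      refine Reach.head ?_ h
      rw [step_dec_false]
      simp

/-- Incrementing the binary output. -/
theorem reach_inc (P : CounterProgram m) (y : Fin m → ℕ) (hy : y P.aux = 0) (o : List Bool)
    (t : ℕ) :
    P.Reach (cfg (some .inc) w o (Function.update y P.aux t))
      (cfg (some .emit) w (List.replicate t false ++ binSucc o) y) (2 * o.length + t + 2) := by
  have carry : ∀ (t : ℕ) (o : List Bool),
      P.Reach (cfg (some .carry) w o (Function.update y P.aux t))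
        (cfg (some .emit) w (List.replicate t false ++ o) y) (t + 1) := by
    intro t
    induction t with
    | zero =>
      intro o
      rw [← hy, Function.update_eq_self, hy]
      exact Reach.step (step_carry_zero P hy)
    | succ t ih =>
      intro o
      have h := ih (false :: o)
      rw [← replicate_append_cons] at h
      refine Reach.head ?_ h
      rw [step_carry_succ P (by simp)]
      simp
  -- Dually to the decrement, `t` counts the ones popped so far, which the carry turns into zeros.
  induction o generalizing t with
  | nil => exact Reach.head (step_inc_nil P) (carry t _) |>.mono (by simp)
  | cons b o ih =>
    cases b with
    | false => exact Reach.head (step_inc_false P) (carry t _) |>.mono (by simp)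
    | true =>
      have h := ih (t + 1)
      refine (Reach.head ?_ (by rwa [replicate_append_cons] at h)).mono
        (t := 2 * o.length + (t + 1) + 2 + 1) ?_
      · rw [step_inc_true]; simp
      · simp; omega

/-- Writing the value of the counter `P.res` in binary. -/
theorem reach_emit (P : CounterProgram m) (y : Fin m → ℕ) (hr : y P.res = 0) (ha : y P.aux = 0)
    (hne : P.aux ≠ P.res) (l a : ℕ) (o : List Bool) (hl : o.length + a ≤ l) :
    P.Reach (cfg (some .emit) w o (Function.update y P.res a))
      (cfg (some (.loop true P.first)) w (binSucc^[a] o) y) (a * (2 * l + 3) + 1) := by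
  induction a generalizing o with
  | zero =>
    rw [Function.update_eq_self_iff.2 hr.symm]
    simpa using Reach.step (step_emit_zero P hr)
  | succ a ih =>
    -- An increment adds at most one digit while `a` drops by one, so `l` bounds the output length
    -- throughout.
    have h := ih (binSucc o) (by have := length_binSucc_le o; omega)
    have h' := reach_inc (w := w) P (Function.update y P.res a) (by simp [hne, ha]) o 0
    rw [Function.update_eq_self_iff.2 (by simp [hne, ha])] at h'
    refine (Reach.head ?_ (h'.trans h)).mono (t := 2 * o.length + 0 + 2 +
      (a * (2 * l + 3) + 1) + 1) (by rw [add_mul]; omega)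
    rw [step_emit_succ P (by simp)]
    simp

end CounterProgram

/-! ### The machine of a linear recurrence -/

/-- The data of the recurrence
`q * s (n + d) + ∑ j < d, c⁻ j * s (n + j) = ∑ j < d, c⁺ j * s (n + j)`. -/
structure NatRecurrence where
  s : ℕ → ℕ
  d : ℕ
  q : ℕ
  p : ℕ → ℕ
  m : ℕ → ℕ
  hd : 1 ≤ d
  hq : 1 ≤ q
  eq : ∀ n, q * s (n + d) + ∑ j ∈ Finset.range d, m j * s (n + j) =
    ∑ j ∈ Finset.range d, p j * s (n + j)

namespace NatRecurrence

open CounterProgram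

variable (S : NatRecurrence)

/-- The counters at the start of the `n`-th round: `d` consecutive terms of the sequence, and two
empty counters. -/
def window (n : ℕ) (k : Fin (S.d + 2)) : ℕ := if (k : ℕ) < S.d then S.s (n + k) else 0

/-- In a round, the counters `j < d` are shifted by one place, while the negative part of the
recurrence is accumulated in the counter `d` and the positive part in the counter `d + 1`; then the
former is subtracted from the latter, which is finally divided by `q`. -/
def program : CounterProgram (S.d + 2) where
  init := S.window 0
  -- The loop of counter `d` performs the subtraction. That of `d + 1` removes `q - 1` marks besides
  -- its own decrement, so it runs once per unit of the quotient.
  sub u k := if (k : ℕ) = S.d + 1 then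
    (if (u : ℕ) = S.d then 1 else if (u : ℕ) = S.d + 1 then S.q - 1 else 0) else 0
  add u k :=
    if (u : ℕ) < S.d then
      (if (k : ℕ) < S.d then (if (k : ℕ) + 1 = u then 1 else 0)
      else if (k : ℕ) = S.d then S.m u else S.p u)
    else if (u : ℕ) = S.d + 1 ∧ (k : ℕ) + 1 = S.d then 1 else 0
  first := 0
  -- The two accumulators are empty between rounds, so they can also serve as auxiliary memory.
  tmp := ⟨S.d, by omega⟩
  aux := ⟨S.d + 1, by omega⟩
  res := 0

/-- The counters in the `n`-th round before the loop of the counter `j`. -/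
def stage (n j : ℕ) (k : Fin (S.d + 2)) : ℕ :=
  if (k : ℕ) < S.d then
    -- Counter `k` is emptied by its own loop and refilled by the next one, except that `k = d - 1`
    -- waits for the division.
    (if (k : ℕ) + 1 < j ∧ ((k : ℕ) + 1 < S.d ∨ j = S.d + 2) then S.s (n + k + 1)
      else if (k : ℕ) < j then 0 else S.s (n + k))
  else if (k : ℕ) = S.d then
    (if j ≤ S.d then ∑ i ∈ Finset.range j, S.m i * S.s (n + i) else 0)
  else
    (if j ≤ S.d then ∑ i ∈ Finset.range j, S.p i * S.s (n + i) else
      if j = S.d + 1 then S.q * S.s (n + S.d) else 0)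

theorem stage_zero (n : ℕ) : S.stage n 0 = S.window n := by
  funext k
  simp [stage, window]

theorem stage_last (n : ℕ) : S.stage n (S.d + 2) = S.window (n + 1) := by
  funext k
  unfold stage window
  split_ifs <;> first | omega | rfl | (congr 1; omega)

/-- The number of iterations of the loop of the counter `j` in the `n`-th round. -/
def count (n j : ℕ) : ℕ :=
  if j = S.d then ∑ i ∈ Finset.range S.d, S.m i * S.s (n + i)
  else if j = S.d + 1 then S.s (n + S.d) else S.s (n + j)

variable {S} {w o : List Bool}

/-- The part of the counters that the loop of the counter `u` leaves unchanged. -/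
def rest (S : NatRecurrence) (n : ℕ) (u k : Fin (S.d + 2)) : ℕ :=
  if k = u then 0 else if (u : ℕ) = S.d then S.stage n (u + 1) k else S.stage n u k

/-- This puts the counters in the form required by `reach_loop_false`. The recurrence enters at `u =
d`: the positive sum is the negative sum plus `q * s (n + d)`, so the subtraction never truncates.
At `u = d + 1` the division by `q` is exact. -/
theorem stage_eq_rest_add (n : ℕ) (u k : Fin (S.d + 2)) :
    S.stage n u k =
      rest S n u k + S.count n u * (S.program.sub u k + if k = u then 1 else 0) := by
  have hq := S.hq
  have heq := S.eq n
  have hk := k.2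
  simp only [rest, Fin.ext_iff, stage, program, count]
  rcases lt_trichotomy (u : ℕ) S.d with hlt | hlt | hlt
  · split_ifs <;> first | omega | (simp; done) | skip
    rw [show (k : ℕ) = u by omega]; simp
  · rw [hlt]
    split_ifs <;> omega
  · have hu' : (u : ℕ) = S.d + 1 := by omega
    rw [hu']
    split_ifs <;> first | omega | (simp; done) | skip
    rw [Nat.sub_add_cancel hq]; ring

/-- For `u < d` the loop moves its term one place down and extends both partial sums by one summand;
for `u = d + 1` it delivers the quotient to counter `d - 1`. -/
theorem stage_succ_eq_rest_add (n : ℕ) (u k : Fin (S.d + 2)) :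
    S.stage n (u + 1) k = rest S n u k + S.count n u * S.program.add u k := by
  have hd := S.hd
  have hk := k.2
  simp only [rest, Fin.ext_iff, stage, program, count, Finset.sum_range_succ]
  rcases lt_trichotomy (u : ℕ) S.d with hlt | hlt | hlt
  · split_ifs <;> first | omega | (simp; done) | skip
    · rw [show n + (u : ℕ) = n + k + 1 by omega]; simp
    · ring
    · ring
  · rw [hlt]
    split_ifs <;> omega
  · have hu' : (u : ℕ) = S.d + 1 := by omega
    rw [hu']
    split_ifs <;> first | omega | (simp; done) | skip
    rw [show n + (k : ℕ) + 1 = n + S.d by omega]; simp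

theorem reach_stage (n : ℕ) (u : Fin (S.d + 2)) :
    S.program.Reach (cfg (some (.loop false u)) w o (S.stage n u))
      (cfg (passLbl _ false (u + 1)) w o (S.stage n (u + 1))) (S.count n u + 1) := by
  have hd := S.hd
  rw [funext (stage_eq_rest_add n u), funext (stage_succ_eq_rest_add n u)]
  exact reach_loop_false S.program u (by simp only [program]; split_ifs <;> omega) _ _
    (by simp [rest])

theorem reach_round {n T : ℕ} (hT : ∀ j < S.d + 2, S.count n j ≤ T) :
    S.program.Reach (cfg (some (.loop false 0)) w o (S.window n))
      (cfg (some .dec) w o (S.window (n + 1))) ((S.d + 2) * (T + 1)) := by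
  have h := reach_pass (w := w) (o := o) S.program false (S.stage n) (T + 1)
    (fun u => (reach_stage n u).mono (Nat.succ_le_succ (hT u u.2))) _ le_rfl
  rw [S.stage_zero, S.stage_last] at h
  simpa [passLbl] using h

theorem reach_rounds {T : ℕ} (v : ℕ) : ∀ (n : ℕ) (w : List Bool), binVal w = v →
    (∀ i < n + v, ∀ j < S.d + 2, S.count i j ≤ T) →
    S.program.Reach (cfg (some .dec) w o (S.window n))
      (cfg (some .emit) [] o (Function.update (S.window (n + v)) S.program.tmp w.length))
      (v * (2 * w.length + 1 + (S.d + 2) * (T + 1)) + w.length + 1) := by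
  have htmp : ∀ n, S.window n S.program.tmp = 0 := fun n => by simp [window, program]
  induction v with
  | zero =>
    intro n w hw _
    have h := reach_dec_zero (o := o) S.program (S.window n) w hw 0
    rw [Function.update_eq_self_iff.2 (htmp n).symm] at h
    simpa using h
  | succ v ih =>
    intro n w hw hT
    obtain ⟨w', h1, h2, h3⟩ := reach_dec_pos (o := o) S.program (S.window n) (htmp n) w (by omega)
    have h := h3 0
    rw [Function.update_eq_self_iff.2 (htmp n).symm] at h
    have h' := ih (n + 1) w' (by omega) (fun i hi => hT i (by omega))
    -- The decremented word has the same length, so all rounds share one cost bound.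
    rw [h2, show n + 1 + v = n + (v + 1) by ring] at h'
    exact ((h.trans (reach_round (hT n (by omega)))).trans h').mono
      (by rw [add_mul v 1, one_mul]; omega)

/-- The machine of a recurrence computes the sequence. -/
theorem reach_halt {n T : ℕ} (hT : ∀ i < n, ∀ j < S.d + 2, S.count i j ≤ T)
    (hs : ∀ i < n + S.d, S.s i ≤ T) (hn : n ≤ T) :
    S.program.Reach (cfg (some .main) (Computability.encodeNat n) [] fun _ => 0)
      (cfg none [] (Computability.encodeNat (S.s n)) fun _ => 0)
      ((2 * S.d + 12) * (T + 1) ^ 2) := by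
  have hd := S.hd
  have h1 := Reach.step (step_main S.program (w := Computability.encodeNat n) (o := []))
  have h2 := reach_rounds (o := []) n 0 (Computability.encodeNat n) (binVal_encodeNat n)
    (by simpa using hT)
  rw [zero_add] at h2
  set l := (Computability.encodeNat n).length with hl
  have hln : l ≤ n := length_encodeNat_le n
  -- The base state is the last window with the result counter emptied and the `l` marks left on
  -- `tmp` by the final zero test.
  have h3 := reach_emit (w := []) S.program
    (Function.update (Function.update (S.window n) S.program.tmp l) 0 0) (by simp [program])
    (by simp [program, window, Fin.ext_iff]) (by simp [program, Fin.ext_iff]) (S.s n) (S.s n) []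
    (by simp)
  have e : Function.update (Function.update (Function.update (S.window n) S.program.tmp l) 0 0)
      S.program.res (S.s n) = Function.update (S.window n) S.program.tmp l := by
    rw [show S.program.res = 0 from rfl, Function.update_idem, Function.update_eq_self_iff,
      Function.update_of_ne (by simp [program, Fin.ext_iff]; omega)]
    simp [window]; omega
  rw [e, iterate_binSucc_nil] at h3
  have h4 := reach_clean (w := []) (o := Computability.encodeNat (S.s n)) S.program
    (x := Function.update (Function.update (S.window n) S.program.tmp l) 0 0) T (fun u => by
      by_cases hu : u = 0
      · subst hu; simp
      · rw [Function.update_of_ne hu]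
        by_cases hu' : u = S.program.tmp
        · subst hu'; simp; omega
        · rw [Function.update_of_ne hu']
          unfold window
          split_ifs
          · exact hs _ (by omega)
          · omega)
  refine (((h1.trans h2).trans h3).trans h4).mono ?_
  have hsn := hs n (by omega)
  -- The summands are initialisation, rounds, output and cleaning.
  calc _ ≤ 1 + (T * (2 * T + 1 + (S.d + 2) * (T + 1)) + T + 1) + (T * (2 * T + 3) + 1) +
        (S.d + 2) * (T + 1) := by gcongr <;> omega
    _ ≤ (2 * S.d + 12) * (T + 1) ^ 2 := by
      ring_nf
      nlinarith

/-- Only the loop of counter `d` runs for a sum of terms, hence the factor from the `m k`. The `p k`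
do not appear, since counter `d + 1` is emptied `q` marks at a time. -/
theorem count_le {A : ℕ} (hA1 : 1 ≤ A) (hA : ∀ n, S.s n ≤ A ^ (n + 1)) (n i j : ℕ)
    (hi : i < n) (hj : j < S.d + 2) :
    S.count i j ≤ (∑ k ∈ Finset.range S.d, S.m k + 1) * A ^ (n + S.d) := by
  have hs : ∀ k ≤ S.d, S.s (i + k) ≤ A ^ (n + S.d) := fun k hk =>
    (hA _).trans (Nat.pow_le_pow_right hA1 (by omega))
  have h1 : ∀ k ≤ S.d, S.s (i + k) ≤ (∑ k ∈ Finset.range S.d, S.m k + 1) * A ^ (n + S.d) :=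
    fun k hk => (hs k hk).trans (Nat.le_mul_of_pos_left _ (by omega))
  unfold count
  split_ifs
  · refine le_trans ?_ (Nat.mul_le_mul_right _ (Nat.le_succ _))
    rw [Finset.sum_mul]
    exact Finset.sum_le_sum fun k hk =>
      Nat.mul_le_mul_left _ (hs k (Finset.mem_range.1 hk).le)
  · exact h1 _ le_rfl
  · exact h1 _ (by omega)

end NatRecurrence

/-! ### Passage to `TM2OutputsInTime` and the final time bound -/

/-- The initial configuration of the machine of a counter program. -/
theorem CounterProgram.initList_eq {m : ℕ} (P : CounterProgram m) (w : List Bool) :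
    initList P.machine w = CounterProgram.cfg (some .main) w [] fun _ => 0 := by
  unfold initList CounterProgram.cfg
  congr 1
  funext k
  cases k <;> rfl

/-- The final configuration of the machine of a counter program. -/
theorem CounterProgram.haltList_eq {m : ℕ} (P : CounterProgram m) (o : List Bool) :
    haltList P.machine o = CounterProgram.cfg none [] o fun _ => 0 := by
  unfold haltList CounterProgram.cfg
  congr 1
  funext k
  cases k <;> rfl

theorem CounterProgram.outputs_of_reach {m : ℕ} {P : CounterProgram m} {w o : List Bool} {t : ℕ}
    (h : P.Reach (CounterProgram.cfg (some .main) w [] fun _ => 0)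
      (CounterProgram.cfg none [] o fun _ => 0) t) :
    Nonempty (TM2OutputsInTime P.machine (w.map (Equiv.refl Bool).symm)
      (some (o.map (Equiv.refl Bool).symm)) t) := by
  obtain ⟨⟨⟨k, h'⟩, hk⟩⟩ := h
  rw [← P.initList_eq, ← P.haltList_eq] at h'
  exact ⟨⟨⟨k, (congrArg (fun l : List Bool => (flip bind (TM2.step P.code))^[k]
    (some (initList P.machine l))) (List.map_id w)).trans (h'.trans
      (congrArg (fun l : List Bool => some (haltList P.machine l)) (List.map_id o).symm))⟩,
    hk⟩⟩

theorem NatRecurrence.isKalmarFunction (S : NatRecurrence) : IsKalmarFunction S.s := by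
  obtain ⟨A, hA2, hA⟩ := exists_le_pow_of_nat_recurrence S.hq S.eq
  set M := ∑ k ∈ Finset.range S.d, S.m k + 1 with hM
  -- With `T = M * A ^ (n + d)`, the factor 2 absorbs the `+ 1` in `T + 1`, and the running time is
  -- at most `B * (A ^ 2) ^ n`.
  set B := (2 * S.d + 12) * (2 * (M * A ^ S.d)) ^ 2 with hB
  obtain ⟨k, hk⟩ := exists_pow_le_expTower (B * A ^ 2)
  refine ⟨⟨S.program.machine, Equiv.refl Bool, Equiv.refl Bool⟩, k, fun n => ?_⟩
  have hpow : A ^ (n + S.d) ≤ M * A ^ (n + S.d) := Nat.le_mul_of_pos_left _ (by omega)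
  have hn : n < A ^ (n + S.d) := calc
    n < 2 ^ n := Nat.lt_two_pow_self
    _ ≤ A ^ n := Nat.pow_le_pow_left hA2 n
    _ ≤ A ^ (n + S.d) := Nat.pow_le_pow_right (by omega) (by omega)
  have h := NatRecurrence.reach_halt (S := S) (n := n) (T := M * A ^ (n + S.d))
    (fun i hi j hj => NatRecurrence.count_le (by omega) hA n i j hi hj)
    (fun i hi => ((hA i).trans (Nat.pow_le_pow_right (by omega) (by omega))).trans hpow)
    (by omega)
  have hB1 : 1 ≤ B := Nat.mul_pos (by omega) (Nat.pow_pos (Nat.mul_pos two_pos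
    (Nat.mul_pos (by omega) (Nat.pow_pos (by omega)))))
  have ht : (2 * S.d + 12) * (M * A ^ (n + S.d) + 1) ^ 2 ≤ (B * A ^ 2) ^ (n + 1) := calc
    (2 * S.d + 12) * (M * A ^ (n + S.d) + 1) ^ 2
        ≤ (2 * S.d + 12) * (2 * (M * A ^ (n + S.d))) ^ 2 := by gcongr; omega
    _ = B * (A ^ 2) ^ n := by rw [hB]; ring
    _ ≤ B ^ (n + 1) * (A ^ 2) ^ (n + 1) := by
      gcongr
      · exact Nat.le_self_pow (by omega) B
      · exact Nat.one_le_pow _ _ (by omega)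
      · omega
    _ = (B * A ^ 2) ^ (n + 1) := (mul_pow _ _ _).symm
  exact CounterProgram.outputs_of_reach (h.mono (ht.trans (hk n)))

theorem mainTheorem6 {R : Type*} [Ring R] [CharZero R] (s : ℕ → ℕ)
    (hs : IsCRecursive (fun n => (s n : R))) : IsKalmarFunction s := by
  obtain ⟨d, q, hd, hq, p, m, h⟩ := hs.exists_nat_recurrence
  exact NatRecurrence.isKalmarFunction ⟨s, d, q, p, m, hd, hq, h⟩
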